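/- Let $H$ be a Hilbert $C^*$-module over a $C^*$-algebra $\mathfrak A$, let $\mathcal L(H)$ be the $C^*$-algebra of adjointable operators on $H$, and let $I$ be the identity operator on $H$. For $T\in\mathcal L(H)$, let $\mathcal R(T)$ be the range of $T$ and let $|T|=(T^*T)^{1/2}$. We say that $T$ has the polar decomposition if there is a partial isometry $U\in\mathcal L(H)$ such that $T=U|T|$ and $U^*U$ is the projection of $H$ onto the norm closure $\overline{\mathcal R(T^*)}$. A pair $(P,Q)$ of elements of $\mathcal L(H)$ is called a quasi-projection pair if $P$ is a projection ($P=P^*=P^2$), $Q$ is an idempotent ($Q=Q^2$), and $$PQ^*P=PQP,\qquad PQ^*(I-P)=-PQ(I-P),\qquad (I-P)Q^*(I-P)=(I-P)Q(I-P).$$ A quasi-projection pair $(P,Q)$ is called semi-harmonious if the operators $P(I-Q)$ and $(I-P)Q$ both have the polar decomposition. Let $P,Q\in\mathcal L(H)$. If at least one of the four pairs $$(P,Q),\qquad (I-P,I-Q),\qquad (P,Q^*),\qquad (I-P,I-Q^*)$$ is a semi-harmonious quasi-projection pair, then all four of them are semi-harmonious quasi-projection pairs. -/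

import Mathlib

/-- `AdjointableOperator A E` is `𝓛(E)`, the set of adjointable operators on the Hilbert
C⋆-module `E` over `A`: the maps `T : E → E` for which there is a map `T⋆ : E → E` with
`⟪T x, y⟫ = ⟪x, T⋆ y⟫` for all `x y`. The adjoint is unique, see `AdjointableOperator.ext`, and
linearity and boundedness of `T` are automatic. -/
structure AdjointableOperator (A E : Type*) [Inner A E] where
  /-- the operator itself -/
  toFun : E → E
  /-- its adjoint -/
  adj : E → E
  inner_adj : ∀ x y : E, inner A (toFun x) y = inner A x (adj y)

namespace AdjointableOperator

variable {A E : Type*} [NonUnitalCStarAlgebra A] [PartialOrder A]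
  [NormedAddCommGroup E] [NormedSpace ℂ E] [SMul A E] [CStarModule A E]

instance : CoeFun (AdjointableOperator A E) (fun _ => E → E) := ⟨toFun⟩

theorem eq_of_inner {x y : E} (h : ∀ z : E, inner A z x = inner A z y) : x = y := by
  have h1 : inner A (x - y) (x - y) = 0 := by
    rw [CStarModule.inner_sub_right, h, sub_self]
  exact sub_eq_zero.mp (CStarModule.inner_self.mp h1)

theorem adj_inner (T : AdjointableOperator A E) (x y : E) :
    inner A (T.adj x) y = inner A x (T.toFun y) := by
  rw [← CStarModule.star_inner, ← T.inner_adj, CStarModule.star_inner]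

theorem ext {S T : AdjointableOperator A E} (h : ∀ x, S x = T x) : S = T := by
  have hf : S.toFun = T.toFun := funext h
  have ha : S.adj = T.adj := by
    funext y
    refine eq_of_inner (A := A) fun z => ?_
    rw [← S.inner_adj, ← T.inner_adj, hf]
  cases S
  cases T
  cases hf
  cases ha
  rfl

theorem map_add (T : AdjointableOperator A E) (x y : E) : T (x + y) = T x + T y := by
  refine eq_of_inner (A := A) fun z => ?_
  rw [CStarModule.inner_add_right, ← T.adj_inner, ← T.adj_inner, ← T.adj_inner,
    CStarModule.inner_add_right]

instance : Zero (AdjointableOperator A E) := ⟨⟨fun _ => 0, fun _ => 0, fun x y => by simp⟩⟩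

instance : One (AdjointableOperator A E) := ⟨⟨fun x => x, fun x => x, fun _ _ => rfl⟩⟩

instance : Add (AdjointableOperator A E) :=
  ⟨fun S T => ⟨fun x => S x + T x, fun x => S.adj x + T.adj x, fun x y => by
    simp [S.inner_adj, T.inner_adj]⟩⟩

instance : Neg (AdjointableOperator A E) :=
  ⟨fun T => ⟨fun x => -T x, fun x => -T.adj x, fun x y => by simp [T.inner_adj]⟩⟩

instance : Mul (AdjointableOperator A E) :=
  ⟨fun S T => ⟨fun x => S (T x), fun x => T.adj (S.adj x), fun x y => by
    rw [S.inner_adj, T.inner_adj]⟩⟩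

instance : Star (AdjointableOperator A E) := ⟨fun T => ⟨T.adj, T.toFun, T.adj_inner⟩⟩

theorem zero_apply (x : E) : (0 : AdjointableOperator A E) x = 0 := rfl

theorem one_apply (x : E) : (1 : AdjointableOperator A E) x = x := rfl

theorem add_apply (S T : AdjointableOperator A E) (x : E) : (S + T) x = S x + T x := rfl

theorem neg_apply (T : AdjointableOperator A E) (x : E) : (-T) x = -T x := rfl

theorem mul_apply (S T : AdjointableOperator A E) (x : E) : (S * T) x = S (T x) := rfl

theorem inner_star (T : AdjointableOperator A E) (x y : E) :
    inner A (T x) y = inner A x ((star T) y) := T.inner_adj x y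

theorem map_zero (T : AdjointableOperator A E) : T 0 = 0 := by
  have h := T.map_add 0 0
  rw [add_zero] at h
  exact left_eq_add.mp h

/-- `𝓛(E)` is a ring under pointwise addition and composition. -/
instance : Ring (AdjointableOperator A E) where
  add_assoc _ _ _ := ext fun _ => add_assoc _ _ _
  zero_add _ := ext fun _ => zero_add _
  add_zero _ := ext fun _ => add_zero _
  add_comm _ _ := ext fun _ => add_comm _ _
  neg_add_cancel _ := ext fun _ => neg_add_cancel _
  mul_assoc _ _ _ := rfl
  one_mul _ := rfl
  mul_one _ := rfl
  zero_mul _ := ext fun _ => rfl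
  mul_zero S := ext fun _ => S.map_zero
  left_distrib S _ _ := ext fun _ => S.map_add _ _
  right_distrib _ _ _ := ext fun _ => rfl
  nsmul := nsmulRec
  zsmul := zsmulRec

/-- `𝓛(E)` is a star ring whose involution is the adjoint. -/
instance : StarRing (AdjointableOperator A E) where
  star_involutive _ := rfl
  star_mul _ _ := rfl
  star_add _ _ := ext fun _ => rfl

/-- `T` is a positive element of the C⋆-algebra `𝓛(E)`. -/
def IsPositive (T : AdjointableOperator A E) : Prop :=
  ∃ S : AdjointableOperator A E, T = star S * S

/-- `R = |T|`: the operator `R` is the positive square root of `T⋆ T`. -/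
def IsAbs (R T : AdjointableOperator A E) : Prop :=
  R.IsPositive ∧ R * R = star T * T

/-- `p = P_M`: the operator `p` is the projection of `E` onto `M`. -/
def IsProjectionOnto (p : AdjointableOperator A E) (M : Set E) : Prop :=
  IsStarProjection p ∧ Set.range p.toFun = M

/-- `U` is a partial isometry. -/
def IsPartialIsometry (U : AdjointableOperator A E) : Prop :=
  U * star U * U = U

/-- `T` has the polar decomposition: there is a partial isometry `U` in `𝓛(E)` such that
`T = U |T|` and `U⋆ U` is the projection onto the norm closure of the range of `T⋆`. -/
def HasPolarDecomposition (T : AdjointableOperator A E) : Prop :=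
  ∃ R U : AdjointableOperator A E, IsAbs R T ∧ IsPartialIsometry U ∧ T = U * R ∧
    IsProjectionOnto (star U * U) (closure (Set.range (star T).toFun))

/-- `(P, Q)` is a quasi-projection pair. -/
structure IsQuasiProjectionPair (P Q : AdjointableOperator A E) : Prop where
  isStarProjection : IsStarProjection P
  isIdempotentElem : IsIdempotentElem Q
  corner₁₁ : P * star Q * P = P * Q * P
  corner₁₂ : P * star Q * (1 - P) = -(P * Q * (1 - P))
  corner₂₂ : (1 - P) * star Q * (1 - P) = (1 - P) * Q * (1 - P)

/-- `(P, Q)` is a semi-harmonious quasi-projection pair: a quasi-projection pair for which both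
`P (I - Q)` and `(I - P) Q` have the polar decomposition. -/
structure IsSemiHarmonious (P Q : AdjointableOperator A E) : Prop where
  isQuasiProjectionPair : IsQuasiProjectionPair P Q
  polar₁ : (P * (1 - Q)).HasPolarDecomposition
  polar₂ : ((1 - P) * Q).HasPolarDecomposition

end AdjointableOperator

namespace AdjointableOperator

variable {A E : Type*} [NonUnitalCStarAlgebra A] [PartialOrder A]
  [NormedAddCommGroup E] [NormedSpace ℂ E] [SMul A E] [CStarModule A E]

/-! Put `J = 2P - I`, a self-adjoint unitary, written `P + P - 1` below. The quasi-projection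
identities say exactly that `Q⋆ = J Q J` (`IsQuasiProjectionPair.star_eq`). Since `P J = P` and `(I
- P) J = -(I - P)`, it follows that `P (I - Q⋆) = P (I - Q) J` and `(I - P) Q⋆ = (I - P) Q (-J)`.
Right multiplication by a unitary preserves the polar decomposition
(`HasPolarDecomposition.mul_unitary`), so `Q` may be replaced by `Q⋆`. Complementing both entries
only swaps the two operators. These two involutive moves connect the four pairs. -/

theorem map_sub (T : AdjointableOperator A E) (x y : E) : T (x - y) = T x - T y := by
  rw [eq_sub_iff_add_eq, ← T.map_add, sub_add_cancel]

/-- Supplies the continuity needed to move a unitary past a closure. -/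
theorem isometry_of_star_mul_self {W : AdjointableOperator A E} (hW : star W * W = 1) :
    Isometry W.toFun := by
  refine Isometry.of_dist_eq fun x y => ?_
  rw [dist_eq_norm, dist_eq_norm, ← W.map_sub, CStarModule.norm_eq_sqrt_norm_inner_self (A := A),
    CStarModule.norm_eq_sqrt_norm_inner_self (A := A) (x - y), W.inner_star, ← mul_apply, hW,
    one_apply]

/-- The underlying homeomorphism of a unitary operator. -/
def unitaryHomeomorph (W : AdjointableOperator A E) (h₁ : star W * W = 1) (h₂ : W * star W = 1) :
    E ≃ₜ E where
  toFun := W.toFun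
  invFun := (star W).toFun
  left_inv x := by rw [← mul_apply, h₁, one_apply]
  right_inv x := by rw [← mul_apply, h₂, one_apply]
  continuous_toFun := (isometry_of_star_mul_self h₁).continuous
  continuous_invFun := (isometry_of_star_mul_self (W := star W) (by rwa [star_star])).continuous

theorem image_closure_of_unitary {W : AdjointableOperator A E} (h₁ : star W * W = 1)
    (h₂ : W * star W = 1) (s : Set E) : W.toFun '' closure s = closure (W.toFun '' s) :=
  (unitaryHomeomorph W h₁ h₂).image_closure s

theorem range_mul (S T : AdjointableOperator A E) :
    Set.range (S * T).toFun = S.toFun '' Set.range T.toFun :=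
  Set.range_comp S.toFun T.toFun

theorem range_mul_of_unitary (S : AdjointableOperator A E) {W : AdjointableOperator A E}
    (h₁ : star W * W = 1) (h₂ : W * star W = 1) :
    Set.range (S * W).toFun = Set.range S.toFun := by
  have h : Set.range W.toFun = Set.univ := (unitaryHomeomorph W h₁ h₂).surjective.range_eq
  rw [range_mul, h, Set.image_univ]

/-- The polar decomposition is preserved by right multiplication by a unitary operator. -/
theorem HasPolarDecomposition.mul_unitary {T W : AdjointableOperator A E}
    (hT : T.HasPolarDecomposition) (h₁ : star W * W = 1) (h₂ : W * star W = 1) :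
    (T * W).HasPolarDecomposition := by
  have hc (X : AdjointableOperator A E) : W * (star W * X) = X := by
    rw [← mul_assoc, h₂, one_mul]
  obtain ⟨R, U, ⟨⟨S, hS⟩, hR⟩, hU, hTU, ⟨hp, hsa⟩, hM⟩ := hT
  -- `|T W| = W⋆ |T| W`, and the partial isometry becomes `U W`.
  refine ⟨star W * R * W, U * W, ⟨⟨S * W, ?_⟩, ?_⟩, ?_, ?_, ⟨?_, ?_⟩, ?_⟩
  · simp only [hS, star_mul, mul_assoc]
  · calc star W * R * W * (star W * R * W) = star W * (R * R) * W := by simp only [mul_assoc, hc]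
      _ = star (T * W) * (T * W) := by rw [hR]; simp only [star_mul, mul_assoc]
  · calc U * W * star (U * W) * (U * W) = U * star U * U * W := by
          simp only [star_mul, mul_assoc, hc]
      _ = U * W := by rw [hU]
  · simp only [mul_assoc, hc]
    rw [← mul_assoc, ← hTU]
  · calc star (U * W) * (U * W) * (star (U * W) * (U * W))
          = star W * (star U * U * (star U * U)) * W := by simp only [star_mul, mul_assoc, hc]
      _ = star (U * W) * (U * W) := by rw [hp]; simp only [star_mul, mul_assoc]
  · exact IsSelfAdjoint.star_mul_self _
  -- Both sides are the image under the homeomorphism `W⋆` of the closed range of `T⋆`.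
  · have h₁' : star (star W) * star W = 1 := by rwa [star_star]
    have h₂' : star W * star (star W) = 1 := by rwa [star_star]
    have e : star (U * W) * (U * W) = star W * (star U * U) * W := by
      simp only [star_mul, mul_assoc]
    rw [e, range_mul_of_unitary _ h₁ h₂, range_mul, hM, image_closure_of_unitary h₁' h₂',
      ← range_mul, star_mul]

theorem symmetry_mul_self {P : AdjointableOperator A E} (hP : IsStarProjection P) :
    (P + P - 1) * (P + P - 1) = 1 := by
  have h : P * P = P := hP.isIdempotentElem
  noncomm_ring [h]

theorem star_symmetry {P : AdjointableOperator A E} (hP : IsStarProjection P) :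
    star (P + P - 1) = P + P - 1 := by
  rw [star_sub, star_add, star_one, hP.isSelfAdjoint.star_eq]

theorem IsQuasiProjectionPair.corner₂₁ {P Q : AdjointableOperator A E}
    (h : IsQuasiProjectionPair P Q) : (1 - P) * star Q * P = -((1 - P) * Q * P) := by
  have := congrArg star h.corner₁₂
  simp only [star_neg, star_mul, star_sub, star_one, star_star,
    h.isStarProjection.isSelfAdjoint.star_eq, ← mul_assoc] at this
  rw [this, neg_neg]

/-- For a quasi-projection pair, `Q⋆` is the conjugate of `Q` by the symmetry `2P - I`. -/
theorem IsQuasiProjectionPair.star_eq {P Q : AdjointableOperator A E}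
    (h : IsQuasiProjectionPair P Q) : star Q = (P + P - 1) * Q * (P + P - 1) := by
  calc star Q = P * star Q * P + P * star Q * (1 - P) + (1 - P) * star Q * P +
        (1 - P) * star Q * (1 - P) := by noncomm_ring
    _ = P * Q * P + -(P * Q * (1 - P)) + -((1 - P) * Q * P) + (1 - P) * Q * (1 - P) := by
        rw [h.corner₁₁, h.corner₁₂, h.corner₂₁, h.corner₂₂]
    _ = (P + P - 1) * Q * (P + P - 1) := by noncomm_ring

theorem IsQuasiProjectionPair.star {P Q : AdjointableOperator A E}
    (h : IsQuasiProjectionPair P Q) : IsQuasiProjectionPair P (star Q) where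
  isStarProjection := h.isStarProjection
  isIdempotentElem := by
    rw [IsIdempotentElem, ← star_mul, h.isIdempotentElem.eq]
  corner₁₁ := by rw [star_star, h.corner₁₁]
  corner₁₂ := by rw [star_star, h.corner₁₂, neg_neg]
  corner₂₂ := by rw [star_star, h.corner₂₂]

theorem IsQuasiProjectionPair.one_sub {P Q : AdjointableOperator A E}
    (h : IsQuasiProjectionPair P Q) : IsQuasiProjectionPair (1 - P) (1 - Q) where
  isStarProjection := h.isStarProjection.one_sub
  isIdempotentElem := h.isIdempotentElem.one_sub
  corner₁₁ := by
    rw [star_sub, star_one, mul_sub (1 - P) 1, sub_mul _ _ (1 - P), h.corner₂₂, ← sub_mul,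
      ← mul_sub]
  corner₁₂ := by
    -- The identity has no off-diagonal block, so only the `Q` terms survive.
    have hP : (1 - P) * 1 * P = 0 := by
      rw [mul_one, sub_mul, one_mul, h.isStarProjection.isIdempotentElem.eq, sub_self]
    rw [sub_sub_cancel, star_sub, star_one, mul_sub (1 - P) 1, sub_mul _ _ P, h.corner₂₁,
      mul_sub (1 - P) 1, sub_mul _ _ P, hP, zero_sub, zero_sub]
  corner₂₂ := by
    rw [sub_sub_cancel, star_sub, star_one, mul_sub, sub_mul, mul_sub, sub_mul _ _ P, h.corner₁₁]

theorem IsSemiHarmonious.one_sub {P Q : AdjointableOperator A E} (h : IsSemiHarmonious P Q) :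
    IsSemiHarmonious (1 - P) (1 - Q) where
  isQuasiProjectionPair := h.isQuasiProjectionPair.one_sub
  polar₁ := by rw [sub_sub_cancel]; exact h.polar₂
  polar₂ := by rw [sub_sub_cancel]; exact h.polar₁

theorem IsSemiHarmonious.star {P Q : AdjointableOperator A E} (h : IsSemiHarmonious P Q) :
    IsSemiHarmonious P (star Q) := by
  have hq := h.isQuasiProjectionPair
  have hP : P * P = P := hq.isStarProjection.isIdempotentElem
  have hJ := symmetry_mul_self hq.isStarProjection
  have hJs := star_symmetry hq.isStarProjection
  have hPJ : P * (P + P - 1) = P := by rw [mul_sub, mul_add, hP, mul_one, add_sub_cancel_right]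
  have hPJ' : (1 - P) * (P + P - 1) = -(1 - P) := by rw [sub_mul, one_mul, hPJ]; abel
  refine ⟨hq.star, ?_, ?_⟩
  · have e : P * (1 - Star.star Q) = P * (1 - Q) * (P + P - 1) := by
      rw [hq.star_eq, mul_sub P, mul_sub P, ← mul_assoc, ← mul_assoc, hPJ, sub_mul (P * 1), mul_one,
        hPJ]
    rw [e]
    exact h.polar₁.mul_unitary (by rw [hJs, hJ]) (by rw [hJs, hJ])
  -- The sign is absorbed into the unitary, which becomes `-J`.
  · have e : (1 - P) * Star.star Q = (1 - P) * Q * -(P + P - 1) := by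
      rw [hq.star_eq, ← mul_assoc, ← mul_assoc, hPJ', neg_mul, neg_mul, mul_neg]
    rw [e]
    exact h.polar₂.mul_unitary (by rw [star_neg, hJs, neg_mul_neg, hJ])
      (by rw [star_neg, hJs, neg_mul_neg, hJ])

end AdjointableOperator

theorem mainTheorem12 {A E : Type*} [NonUnitalCStarAlgebra A] [PartialOrder A] [StarOrderedRing A]
    [NormedAddCommGroup E] [NormedSpace ℂ E] [SMul A E] [CStarModule A E] [CompleteSpace E]
    (P Q : AdjointableOperator A E)
    (h : AdjointableOperator.IsSemiHarmonious P Q ∨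
      AdjointableOperator.IsSemiHarmonious (1 - P) (1 - Q) ∨
      AdjointableOperator.IsSemiHarmonious P (star Q) ∨
      AdjointableOperator.IsSemiHarmonious (1 - P) (1 - star Q)) :
    AdjointableOperator.IsSemiHarmonious P Q ∧
      AdjointableOperator.IsSemiHarmonious (1 - P) (1 - Q) ∧
      AdjointableOperator.IsSemiHarmonious P (star Q) ∧
      AdjointableOperator.IsSemiHarmonious (1 - P) (1 - star Q) := by
  -- Both moves are involutions, so each alternative leads back to `(P, Q)`.
  suffices h : AdjointableOperator.IsSemiHarmonious P Q from
    ⟨h, h.one_sub, h.star, by simpa only [star_sub, star_one] using h.one_sub.star⟩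
  rcases h with h | h | h | h
  · exact h
  · simpa only [sub_sub_cancel] using h.one_sub
  · simpa only [star_star] using h.star
  · simpa only [sub_sub_cancel, star_star] using h.one_sub.star
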